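/- Let $A$ and $B$ be $C^*$-algebras, let $E_B$ be a right Hilbert $B$-module, let $S$ be a set, and let $k:S\times S\to\mathbb B(A,\mathcal L(E_B))$ be a map. Here $\mathcal L(E_B,E)$ denotes the space of adjointable operators between right Hilbert $B$-modules, $\mathcal L(E)=\mathcal L(E,E)$, and $\mathbb B(A,\mathcal L(E_B))$ denotes the bounded linear maps. An $A$-$B$-$C^*$-correspondence is a right Hilbert $B$-module $E$ together with a nondegenerate $^*$-homomorphism $\varphi_E:A\to\mathcal L(E)$, i.e. $\varphi_E(A)E$ is linearly dense in $E$. An approximate unit of $A$ is a net $(e_i)$ of positive elements with $\|e_i\|\le 1$ such that $e_ia\to a$ and $ae_i\to a$ for all $a\in A$. A net $(T_i)$ in $\mathcal L(E_B)$ converges strictly to $T\in\mathcal L(E_B)$ if $T_i\xi\to T\xi$ and $T_i^*\xi\to T^*\xi$ for all $\xi\in E_B$. The following are equivalent: 1. There exist an $A$-$B$-$C^*$-correspondence $E$ and a map $\zeta:S\to\mathcal L(E_B,E)$ such that $$k(s,t)(a)=\zeta(s)^*\varphi_E(a)\zeta(t),\qquad s,t\in S,\ a\in A.$$ 2. $k$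 is positive-definite, i.e. for all $n\in\mathbb N$, $s_1,\dots,s_n\in S$, $a_1,\dots,a_n\in A$ and $\xi_1,\dots,\xi_n\in E_B$, $$\sum_{i,j=1}^n\langle\xi_i,k(s_i,s_j)(a_i^*a_j)\xi_j\rangle_B\ge 0,$$ and $k$ is strict, i.e. for each $s\in S$ the net $(k(s,s)(e_i))_i$ converges strictly in $\mathcal L(E_B)$ for some (equivalently, under the positive-definiteness of $k$, for every) approximate unit $(e_i)_i$ of $A$. If these conditions hold, then the pair $(\zeta,E)$ in 1. may be chosen to be minimal, i.e. such that $\{\varphi_E(a)\zeta(s)\xi: a\in A,\ s\in S,\ \xi\in E_B\}$ is linearly dense in $E$. If $(\zeta,E)$ and $(\zeta',E')$ are two minimal pairs as in 1., then there is a unique unitary isomorphism of $C^*$-correspondences $U:E\to E'$ (a unitary $U\in\mathcal L(E,E')$ with $U\varphi_E(a)=\varphi_{E'}(a)U$ for all $a\in A$) such that $U\zeta(s)=\zeta'(s)$ for all $s\in S$. -/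

import Mathlib

open Filter Topology

universe u v w x y y₁ y₂

/-! ### Right Hilbert modules

Mathlib's `CStarModule C E` is a Hilbert module with an action `c • x` satisfying
`inner C x (c • y) = c * inner C x y`.  For `C = Bᵐᵒᵖ` this is exactly a *right* Hilbert
`B`-module: `x · b` is `MulOpposite.op b • x`, and `⟨x, y⟩_B` is `inner Bᵐᵒᵖ x y` read in `B`;
the norm of `E` is `‖⟨x, x⟩‖ ^ (1/2)`, and completeness is the instance `CompleteSpace E`. -/

section Adjointable

/-- The `B`-valued inner product of a right Hilbert `B`-module
(conjugate-linear in the first variable, `B`-linear in the second one). -/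
def rightInner (B : Type*) {E : Type*} [Inner Bᵐᵒᵖ E] (x y : E) : B :=
  MulOpposite.unop (inner Bᵐᵒᵖ x y)

variable (B : Type*) [NonUnitalCStarAlgebra B] [PartialOrder B]
variable (E : Type*) [NormedAddCommGroup E] [NormedSpace ℂ E] [SMul Bᵐᵒᵖ E] [CStarModule Bᵐᵒᵖ E]
variable (F : Type*) [NormedAddCommGroup F] [NormedSpace ℂ F] [SMul Bᵐᵒᵖ F] [CStarModule Bᵐᵒᵖ F]
variable (G : Type*) [NormedAddCommGroup G] [NormedSpace ℂ G] [SMul Bᵐᵒᵖ G] [CStarModule Bᵐᵒᵖ G]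

variable {E} in
theorem rightInner_op_smul_right (x y : E) (b : B) :
    rightInner B x (MulOpposite.op b • y) = rightInner B x y * b := by
  simp [rightInner]

variable {E} in
theorem star_rightInner (x y : E) : star (rightInner B x y) = rightInner B y x := by
  rw [rightInner, ← MulOpposite.unop_star, CStarModule.star_inner, rightInner]

variable {E} in
theorem rightInner_self_nonneg (x : E) : 0 ≤ rightInner B x x :=
  MulOpposite.unop_nonneg.2 CStarModule.inner_self_nonneg

variable {E} in
theorem rightInner_left_injective {x y : E}
    (h : ∀ z : E, rightInner B z x = rightInner B z y) : x = y := by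
  have h' : inner Bᵐᵒᵖ (x - y) (x - y) = 0 := by
    rw [CStarModule.inner_sub_right, sub_eq_zero]
    exact MulOpposite.unop_injective (h (x - y))
  exact sub_eq_zero.1 (CStarModule.inner_self.1 h')

/-- The adjointable operators `E → F`, as a subspace of the bounded linear operators
(maps with an adjoint, and the adjoints themselves, are automatically linear and bounded). -/
def adjointableSubmodule : Submodule ℂ (E →L[ℂ] F) where
  carrier := {T | ∃ T' : F →L[ℂ] E, ∀ x y, rightInner B (T x) y = rightInner B x (T' y)}
  zero_mem' := ⟨0, fun x y => by simp [rightInner]⟩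
  add_mem' := by
    rintro T R ⟨T', hT⟩ ⟨R', hR⟩
    refine ⟨T' + R', fun x y => ?_⟩
    have h1 := hT x y
    have h2 := hR x y
    simp only [rightInner] at h1 h2 ⊢
    simp [h1, h2]
  smul_mem' := by
    rintro c T ⟨T', hT⟩
    refine ⟨star c • T', fun x y => ?_⟩
    have h1 := hT x y
    simp only [rightInner] at h1 ⊢
    simp [h1]

/-- The space `𝓛(E, F)` of adjointable operators, with the operator norm. -/
abbrev Adjointable : Type _ := ↥(adjointableSubmodule B E F)

instance : CoeFun (Adjointable B E F) (fun _ => E → F) := ⟨fun T => T.1⟩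

namespace Adjointable

variable {B E F G}

theorem ext' {T R : Adjointable B E F} (h : ∀ x, T x = R x) : T = R :=
  Subtype.ext (ContinuousLinearMap.ext h)

/-- The adjoint `T* : F → E` of an adjointable operator `T : E → F`. -/
noncomputable def adjoint (T : Adjointable B E F) : Adjointable B F E :=
  ⟨Classical.choose T.2, T.1, fun y x => by
    rw [← star_rightInner, ← star_rightInner B (T.1 x) y]
    exact congrArg star (Classical.choose_spec T.2 x y).symm⟩

theorem rightInner_adjoint_right (T : Adjointable B E F) (x : E) (y : F) :
    rightInner B x (adjoint T y) = rightInner B (T x) y :=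
  (Classical.choose_spec T.2 x y).symm

theorem eq_adjoint {T : Adjointable B E F} {R : Adjointable B F E}
    (h : ∀ x y, rightInner B x (R y) = rightInner B (T x) y) : R = adjoint T :=
  ext' fun y => rightInner_left_injective B fun x => by rw [h, rightInner_adjoint_right]

theorem rightInner_adjoint_left (T : Adjointable B E F) (x : E) (y : F) :
    rightInner B (adjoint T y) x = rightInner B y (T x) := by
  rw [← star_rightInner, rightInner_adjoint_right, star_rightInner]

theorem adjoint_adjoint (T : Adjointable B E F) : adjoint (adjoint T) = T :=
  (eq_adjoint fun y x => (rightInner_adjoint_left T x y).symm).symm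

/-- Composition of adjointable operators. -/
noncomputable def comp (T : Adjointable B F G) (R : Adjointable B E F) : Adjointable B E G :=
  ⟨T.1.comp R.1, (adjoint R).1.comp (adjoint T).1, fun x y => by
    simp only [ContinuousLinearMap.comp_apply]
    rw [rightInner_adjoint_right, rightInner_adjoint_right]⟩

theorem comp_apply (T : Adjointable B F G) (R : Adjointable B E F) (x : E) :
    comp T R x = T (R x) := rfl

/-- The identity operator. -/
def id : Adjointable B E E := ⟨ContinuousLinearMap.id ℂ E, ContinuousLinearMap.id ℂ E,
  fun _ _ => rfl⟩

/-- `𝓛(E) = 𝓛(E, E)` is a ring under composition. -/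
noncomputable instance : Ring (Adjointable B E E) :=
  { (inferInstance : AddCommGroup (Adjointable B E E)) with
    mul := comp
    one := id
    mul_assoc := fun _ _ _ => rfl
    one_mul := fun _ => rfl
    mul_one := fun _ => rfl
    zero_mul := fun _ => rfl
    mul_zero := fun T => ext' fun _ => map_zero T.1
    left_distrib := fun T _ _ => ext' fun _ => map_add T.1 _ _
    right_distrib := fun _ _ _ => rfl }

/-- `𝓛(E)` is a `*`-ring with the adjoint as involution. -/
noncomputable instance : StarRing (Adjointable B E E) where
  star := adjoint
  star_involutive := adjoint_adjoint
  star_mul T R := (eq_adjoint fun x y => by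
    change rightInner B x (adjoint R (adjoint T y)) = rightInner B (T (R x)) y
    rw [rightInner_adjoint_right, rightInner_adjoint_right]).symm
  star_add T R := (eq_adjoint fun x y => by
    have h1 := rightInner_adjoint_right T x y
    have h2 := rightInner_adjoint_right R x y
    change rightInner B x (adjoint T y + adjoint R y) = rightInner B (T x + R x) y
    simp only [rightInner] at h1 h2 ⊢
    simp [h1, h2]).symm

/-- `U` is unitary: `U* U = 1` and `U U* = 1`. -/
def IsUnitary (U : Adjointable B E F) : Prop :=
  comp (adjoint U) U = id ∧ comp U (adjoint U) = id

/-- Convergence `T i → R` along `l` in the strict topology of `𝓛(E, F)`, that is, for the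
seminorms `T ↦ ‖T x‖` and `T ↦ ‖T* y‖`. -/
def StrictlyTendsto {ι : Type*} (T : ι → Adjointable B E F) (l : Filter ι)
    (R : Adjointable B E F) : Prop :=
  (∀ x, Tendsto (fun i => T i x) l (𝓝 (R x))) ∧
    ∀ y, Tendsto (fun i => adjoint (T i) y) l (𝓝 (adjoint R y))

end Adjointable

end Adjointable

/-- A `C*`-correspondence from `A` to `B`: a right Hilbert `B`-module `E` with a nondegenerate
`*`-homomorphism `A → 𝓛(E)`. -/
structure CStarCorrespondence (A : Type u) [NonUnitalCStarAlgebra A]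
    (B : Type v) [NonUnitalCStarAlgebra B] [PartialOrder B] where
  carrier : Type w
  [normedAddCommGroup : NormedAddCommGroup carrier]
  [normedSpace : NormedSpace ℂ carrier]
  [completeSpace : CompleteSpace carrier]
  [rightSMul : SMul Bᵐᵒᵖ carrier]
  [cstarModule : CStarModule Bᵐᵒᵖ carrier]
  leftAction : A →⋆ₙₐ[ℂ] Adjointable B carrier carrier
  nondegenerate :
    Dense (Submodule.span ℂ {x : carrier | ∃ a y, x = leftAction a y} : Set carrier)

namespace CStarCorrespondence

attribute [instance] normedAddCommGroup normedSpace completeSpace rightSMul cstarModule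

instance {A B : Type*} [NonUnitalCStarAlgebra A] [NonUnitalCStarAlgebra B] [PartialOrder B] :
    CoeSort (CStarCorrespondence A B) (Type _) := ⟨carrier⟩

/-- `U : E → E'` is a unitary isomorphism of correspondences: a unitary adjointable operator
(hence right `B`-linear) that intertwines the left actions of `A`. -/
def IsUnitaryIso {A B : Type*} [NonUnitalCStarAlgebra A] [NonUnitalCStarAlgebra B]
    [PartialOrder B] {E E' : CStarCorrespondence A B} (U : Adjointable B E E') : Prop :=
  U.IsUnitary ∧ ∀ a : A, U.comp (E.leftAction a) = (E'.leftAction a).comp U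

end CStarCorrespondence

section Kernels

variable {S A B F : Type*} [NonUnitalCStarAlgebra A] [NonUnitalCStarAlgebra B] [PartialOrder B]
variable [NormedAddCommGroup F] [NormedSpace ℂ F] [SMul Bᵐᵒᵖ F] [CStarModule Bᵐᵒᵖ F]

/-- The kernel `k : S × S → 𝔹(A, 𝓛(F))` is positive-definite. -/
def IsPositiveDefiniteKernel (k : S → S → A →L[ℂ] Adjointable B F F) : Prop :=
  ∀ (n : ℕ) (s : Fin n → S) (a : Fin n → A) (ξ : Fin n → F),
    0 ≤ ∑ i, ∑ j, rightInner B (ξ i) (k (s i) (s j) (star (a i) * a j) (ξ j))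

/-- `T : A → 𝓛(F)` is strict along the approximate unit `l` of `A` (given as a filter; for a net
`e : ι → A` this is `Filter.map e atTop`): `T e` converges strictly in `𝓛(F)` as `e` runs
along `l`. -/
def IsStrictAlong (T : A →L[ℂ] Adjointable B F F) (l : Filter A) : Prop :=
  ∃ R : Adjointable B F F, Adjointable.StrictlyTendsto (fun e : A => T e) l R

/-- The pair `(ζ, E)` is a decomposition of `k`: `k(s,t)(a) = ζ(s)* φ_E(a) ζ(t)`. -/
def IsDecomposition (k : S → S → A →L[ℂ] Adjointable B F F) (E : CStarCorrespondence A B)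
    (ζ : S → Adjointable B F E) : Prop :=
  ∀ (s t : S) (a : A), k s t a = (ζ s).adjoint.comp ((E.leftAction a).comp (ζ t))

/-- The pair `(ζ, E)` is minimal: the vectors `a ζ(s) ξ` are linearly dense in `E`. -/
def IsMinimalPair (E : CStarCorrespondence A B) (ζ : S → Adjointable B F E) : Prop :=
  Dense (Submodule.span ℂ {x : E | ∃ (a : A) (s : S) (ξ : F), x = E.leftAction a (ζ s ξ)} : Set E)

end Kernels

/-!
In a decomposition, the vectors `φ(a) ζ(s) ξ` have Gram matrix `⟨ξ, k(s,t)(a* b) η⟩`, which involves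
`k` only.  Minimal decompositions therefore have dense families with equal Gram matrices, and
exchanging these families is a unitary: this is uniqueness, and positivity of `k` is positivity of
the Gram matrix.

Conversely, a positive-definite `k` makes the free vector space on the symbols `a ⊗ s ⊗ ξ` a
semi-inner product `B`-module, with `b` acting on `ξ`; let `E` be its Hausdorff completion.  The
left multiplication `b ⊗ s ⊗ ξ ↦ a b ⊗ s ⊗ ξ` is contractive for `‖a‖ ≤ 1`: the orbit map `a ↦ a x`
extends to the unitization of `A`, where `‖a‖² - a* a` has the form `d* d`, so that
`‖a‖² ⟨x, x⟩ - ⟨a x, a x⟩ = ⟨d x, d x⟩ ≥ 0`.  If `A` is not unital, `ζ(s) ξ` is the limit of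
`e ⊗ s ⊗ ξ` along an approximate unit.  The limit exists by strictness, since `e² ≤ e` gives
`‖e ⊗ s ⊗ ξ - e' ⊗ s ⊗ ξ‖² ≤ ‖⟨ξ, k(s,s)(e - e e' - e' e + e') ξ⟩‖`, whose limit in `e` is
`‖⟨ξ, R ξ⟩ - ⟨ξ, k(s,s)(e') ξ⟩‖`, where `R` is the strict limit of `k(s,s)`.
-/

/-! ### Completion of semi-inner product modules -/

/-- A semi-inner product module over a `C*`-algebra `C`, in the convention of `CStarModule` but with
a possibly degenerate form and no topology.  The action of `C` need not satisfy the module laws: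
these hold up to null vectors, by `form_smul`. -/
structure PreHilbertModule (C W : Type*) [NonUnitalCStarAlgebra C] [PartialOrder C]
    [AddCommGroup W] [Module ℂ W] where
  form : W →ₗ⋆[ℂ] W →ₗ[ℂ] C
  smul : C → W →ₗ[ℂ] W
  form_self_nonneg : ∀ x, 0 ≤ form x x
  form_smul : ∀ c x y, form x (smul c y) = c * form x y

namespace PreHilbertModule

variable {C W : Type*} [NonUnitalCStarAlgebra C] [PartialOrder C]
  [AddCommGroup W] [Module ℂ W] (H : PreHilbertModule C W)

/-- The space `W` with the seminorm of the form of `H`. -/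
def Space (_ : PreHilbertModule C W) : Type _ := W

instance : AddCommGroup H.Space := inferInstanceAs (AddCommGroup W)
instance : Module ℂ H.Space := inferInstanceAs (Module ℂ W)

/-- The structure `H`, seen on its seminormed copy. -/
def onSpace : PreHilbertModule C H.Space := H

instance : SMul C H.Space := ⟨fun c => H.onSpace.smul c⟩
noncomputable instance : Inner C H.Space := ⟨fun x y => H.onSpace.form x y⟩
noncomputable instance : Norm H.Space := ⟨fun x => √‖H.onSpace.form x x‖⟩

theorem norm_eq_sqrt (x : H.Space) : ‖x‖ = √‖H.onSpace.form x x‖ := rfl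

theorem norm_sq_eq (x : H.Space) : ‖x‖ ^ 2 = ‖H.onSpace.form x x‖ := Real.sq_sqrt (norm_nonneg _)

variable [StarOrderedRing C]

theorem isSelfAdjoint_form_self (x : W) : IsSelfAdjoint (H.form x x) :=
  .of_nonneg (H.form_self_nonneg x)

theorem star_form (x y : W) : star (H.form x y) = H.form y x := by
  have hadd := (H.isSelfAdjoint_form_self (x + y)).star_eq
  have hI := (H.isSelfAdjoint_form_self (x + Complex.I • y)).star_eq
  simp only [map_add, LinearMap.add_apply, map_smul, map_smulₛₗ, LinearMap.smul_apply, star_add,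
    star_smul, (H.isSelfAdjoint_form_self _).star_eq, Complex.star_def,
    Complex.conj_I, map_neg] at hadd hI
  linear_combination (norm := skip) (1 / 2 : ℂ) • hadd + (Complex.I / 2) • hI
  match_scalars <;> ring_nf <;> simp only [Complex.I_sq] <;> norm_num

theorem form_smul_left (c : C) (x y : W) : H.form (H.smul c x) y = H.form x y * star c := by
  rw [← H.star_form, H.form_smul, star_mul, H.star_form]

theorem form_mul_form_swap_le (x y : W) {t : ℝ} (ht : ‖H.form x x‖ < t) :
    H.form x y * H.form y x ≤ t • H.form y y := by
  have ht0 : 0 < t := (norm_nonneg _).trans_lt ht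
  set a := H.form x y with ha
  have hya : H.form y x = star a := (H.star_form x y).symm
  have hconj : a * H.form x x * star a ≤ t • (a * star a) :=
    (CStarAlgebra.star_right_conjugate_le_norm_smul (H.isSelfAdjoint_form_self x)).trans
      (smul_le_smul_of_nonneg_right ht.le (mul_star_self_nonneg a))
  have hnonneg : 0 ≤ a * H.form x x * star a - t • (a * star a)
      + (t • t • H.form y y - t • (a * star a)) := by
    convert H.form_self_nonneg (H.smul a x - (t : ℂ) • y) using 1
    simp only [map_sub, map_smul, map_smulₛₗ, LinearMap.sub_apply, LinearMap.smul_apply,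
      H.form_smul, H.form_smul_left, hya, ← ha, Complex.conj_ofReal, mul_assoc]
    simp only [Complex.coe_smul, smul_sub]
    abel
  rw [hya]
  refine (smul_le_smul_iff_of_pos_left ht0).1 (sub_nonneg.1 (hnonneg.trans ?_))
  exact add_le_of_nonpos_left (sub_nonpos.2 hconj)

theorem norm_form_sq_le (x y : W) : ‖H.form x y‖ ^ 2 ≤ ‖H.form x x‖ * ‖H.form y y‖ := by
  refine le_mul_of_forall_lt₀ fun t ht r hr => ?_
  have h := CStarAlgebra.norm_le_norm_of_nonneg_of_le
    (by rw [← H.star_form x y]; exact mul_star_self_nonneg _) (H.form_mul_form_swap_le x y ht)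
  have ht0 : 0 ≤ t := (norm_nonneg _).trans ht.le
  rw [← H.star_form x y, CStarRing.norm_self_mul_star, ← sq, norm_smul,
    Real.norm_of_nonneg ht0] at h
  exact h.trans (by gcongr)

theorem norm_form_le (x y : W) : ‖H.form x y‖ ≤ √‖H.form x x‖ * √‖H.form y y‖ := by
  rw [← Real.sqrt_mul (norm_nonneg _)]
  exact Real.le_sqrt_of_sq_le (H.norm_form_sq_le x y)

theorem norm_form_le_norm_mul_norm (x y : H.Space) : ‖H.onSpace.form x y‖ ≤ ‖x‖ * ‖y‖ :=
  H.onSpace.norm_form_le x y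

theorem seminormedSpaceCore : SeminormedSpace.Core ℂ H.Space where
  norm_nonneg _ := Real.sqrt_nonneg _
  norm_smul c x := by simp [norm_eq_sqrt, norm_smul, ← mul_assoc]
  norm_triangle x y := by
    have hnonneg (z : H.Space) : 0 ≤ ‖z‖ := Real.sqrt_nonneg _
    refine (sq_le_sq₀ (hnonneg _) (add_nonneg (hnonneg x) (hnonneg y))).1 ?_
    calc ‖x + y‖ ^ 2
        = ‖H.onSpace.form x x + H.onSpace.form x y
            + (H.onSpace.form y x + H.onSpace.form y y)‖ := by
          simp only [norm_sq_eq, map_add, LinearMap.add_apply, add_add_add_comm]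
      _ ≤ ‖x‖ ^ 2 + ‖x‖ * ‖y‖ + (‖y‖ * ‖x‖ + ‖y‖ ^ 2) := by
          rw [norm_sq_eq, norm_sq_eq]
          refine (norm_add_le _ _).trans (add_le_add ?_ ?_) <;>
            refine (norm_add_le _ _).trans (add_le_add ?_ ?_) <;>
            first | rfl | exact H.norm_form_le_norm_mul_norm _ _
      _ = (‖x‖ + ‖y‖) ^ 2 := by ring

noncomputable instance : SeminormedAddCommGroup H.Space := .ofCore H.seminormedSpaceCore

noncomputable instance : NormedSpace ℂ H.Space where
  norm_smul_le c x := (H.seminormedSpaceCore.norm_smul c x).le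

theorem norm_smul_le (c : C) (x : H.Space) : ‖H.onSpace.smul c x‖ ≤ ‖c‖ * ‖x‖ := by
  refine (sq_le_sq₀ (norm_nonneg _) (by positivity)).1 ?_
  calc ‖H.onSpace.smul c x‖ ^ 2 = ‖c * (H.onSpace.form x x * star c)‖ := by
        rw [norm_sq_eq, form_smul, form_smul_left]
    _ ≤ ‖c‖ * (‖H.onSpace.form x x‖ * ‖star c‖) :=
        norm_mul_le_of_le le_rfl (norm_mul_le _ _)
    _ = (‖c‖ * ‖x‖) ^ 2 := by rw [norm_star, mul_pow, norm_sq_eq]; ring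

instance : UniformContinuousConstSMul C H.Space where
  uniformContinuous_const_smul c :=
    ((H.onSpace.smul c).mkContinuous ‖c‖ (H.norm_smul_le c)).uniformContinuous

theorem continuous_form : Continuous fun p : H.Space × H.Space => H.onSpace.form p.1 p.2 := by
  let formSL : H.Space →L⋆[ℂ] H.Space →L[ℂ] C :=
    H.onSpace.form.mkContinuous₂ 1 fun x y => by simpa using H.norm_form_le_norm_mul_norm x y
  exact (formSL.continuous.comp continuous_fst).clm_apply continuous_snd

open UniformSpace (Completion)

theorem inner_coe (x y : H.Space) :
    inner C (x : Completion H.Space) (y : Completion H.Space) = H.onSpace.form x y :=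
  (Completion.isDenseInducing_coe.prodMap Completion.isDenseInducing_coe).extend_eq
    H.continuous_form (x, y)

theorem continuous_inner_completion :
    Continuous fun p : Completion H.Space × Completion H.Space => (inner C p.1 p.2 : C) := by
  let form' : H.Space →+ H.Space →+ C :=
    { toFun x := (H.onSpace.form x).toAddMonoidHom
      map_zero' := by ext; simp
      map_add' _ _ := by ext; simp }
  exact (Completion.isDenseInducing_toCompl H.Space).extend_Z_bilin
    (Completion.isDenseInducing_toCompl H.Space) (φ := form') H.continuous_form

theorem continuous_inner {X : Type*} [TopologicalSpace X] {f g : X → Completion H.Space}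
    (hf : Continuous f) (hg : Continuous g) : Continuous fun t => (inner C (f t) (g t) : C) :=
  H.continuous_inner_completion.comp (hf.prodMk hg)

theorem norm_completion_eq_sqrt (x : Completion H.Space) : ‖x‖ = √‖(inner C x x : C)‖ := by
  induction x using Completion.induction_on with
  | hp =>
    exact isClosed_eq continuous_norm (H.continuous_inner continuous_id continuous_id).norm.sqrt
  | ih x => rw [inner_coe, Completion.norm_coe, norm_eq_sqrt]

noncomputable instance : CStarModule C (Completion H.Space) where
  inner_add_right {x y z} := by
    induction x, y, z using Completion.induction_on₃ with
    | hp =>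
      exact isClosed_eq (H.continuous_inner (by fun_prop) (by fun_prop))
        ((H.continuous_inner (by fun_prop) (by fun_prop)).add
          (H.continuous_inner (by fun_prop) (by fun_prop)))
    | ih x y z => simp only [← Completion.coe_add, inner_coe, map_add]
  inner_self_nonneg {x} := by
    induction x using Completion.induction_on with
    | hp => exact isClosed_Ici.preimage (H.continuous_inner continuous_id continuous_id)
    | ih x => simpa only [inner_coe] using H.onSpace.form_self_nonneg x
  inner_self {x} := by
    rw [← norm_eq_zero (a := x), norm_completion_eq_sqrt, Real.sqrt_eq_zero (norm_nonneg _),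
      norm_eq_zero]
  inner_op_smul_right {c x y} := by
    induction x, y using Completion.induction_on₂ with
    | hp =>
      exact isClosed_eq (H.continuous_inner continuous_fst (continuous_snd.const_smul c))
        ((H.continuous_inner continuous_fst continuous_snd).const_mul c)
    | ih x y =>
      simp only [← Completion.coe_smul, inner_coe]
      exact H.onSpace.form_smul c x y
  inner_smul_right_complex {z x y} := by
    induction x, y using Completion.induction_on₂ with
    | hp =>
      exact isClosed_eq (H.continuous_inner continuous_fst (continuous_snd.const_smul z))
        ((H.continuous_inner continuous_fst continuous_snd).const_smul z)
    | ih x y => simp only [← Completion.coe_smul, inner_coe, map_smul]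
  star_inner x y := by
    induction x, y using Completion.induction_on₂ with
    | hp =>
      exact isClosed_eq (H.continuous_inner continuous_fst continuous_snd).star
        (H.continuous_inner continuous_snd continuous_fst)
    | ih x y => simp only [inner_coe, star_form]
  norm_eq_sqrt_norm_inner_self := H.norm_completion_eq_sqrt

/-- The canonical map from a semi-inner product module to its Hausdorff completion. -/
noncomputable def toCompletion : W →ₗ[ℂ] Completion H.Space :=
  (Completion.toComplₗᵢ (𝕜 := ℂ) (E := H.Space)).toLinearMap

theorem inner_toCompletion (x y : W) :
    inner C (H.toCompletion x) (H.toCompletion y) = H.form x y :=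
  H.inner_coe x y

theorem denseRange_toCompletion : DenseRange H.toCompletion :=
  Completion.denseRange_coe (α := H.Space)

end PreHilbertModule

section Matrix

variable {P C : Type*} [AddCommMonoid C] [Module ℂ C]

/-- The sesquilinear form on the free complex vector space over `P` with matrix `K`. -/
noncomputable def sesquilinearOfMatrix (K : P → P → C) :
    (P →₀ ℂ) →ₗ⋆[ℂ] (P →₀ ℂ) →ₗ[ℂ] C :=
  LinearMap.mk₂'ₛₗ (starRingEnd ℂ) (RingHom.id ℂ)
    (fun f g => f.sum fun p c => star c • Finsupp.linearCombination ℂ (K p) g)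
    (fun f f' g => Finsupp.sum_add_index' (by simp) (by simp [add_smul]))
    (fun c f g => by
      rw [Finsupp.sum_smul_index (by simp), Finsupp.smul_sum]
      simp [mul_smul])
    (fun f g g' => by simp only [map_add, smul_add, Finsupp.sum_add])
    (fun c f g => by simp [Finsupp.smul_sum, smul_comm c])

theorem sesquilinearOfMatrix_single_single (K : P → P → C) (p q : P) (c d : ℂ) :
    sesquilinearOfMatrix K (.single p c) (.single q d) = (star c * d) • K p q := by
  simp [sesquilinearOfMatrix, mul_smul]

theorem sesquilinearOfMatrix_self (K : P → P → C) (f : P →₀ ℂ) :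
    sesquilinearOfMatrix K f f =
      ∑ p ∈ f.support, ∑ q ∈ f.support, (star (f p) * f q) • K p q := by
  simp [sesquilinearOfMatrix, mul_smul, Finsupp.linearCombination_apply, Finsupp.sum,
    Finset.smul_sum]

end Matrix

/-- The semi-inner product module freely spanned by `P`, with Gram matrix `K` and with the action
of `C` that moves the generators according to `ρ`. -/
noncomputable def PreHilbertModule.ofMatrix {P C : Type*} [NonUnitalCStarAlgebra C]
    [PartialOrder C] (K : P → P → C) (ρ : C → P → P)
    (hK : ∀ f, 0 ≤ sesquilinearOfMatrix K f f) (hρ : ∀ c p q, K p (ρ c q) = c * K p q) :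
    PreHilbertModule C (P →₀ ℂ) where
  form := sesquilinearOfMatrix K
  smul c := Finsupp.lmapDomain ℂ ℂ (ρ c)
  form_self_nonneg := hK
  form_smul c x y := by
    induction x using Finsupp.induction_linear with
    | zero => simp
    | add x x' hx hx' => simp only [map_add, LinearMap.add_apply, hx, hx', mul_add]
    | single p z =>
      induction y using Finsupp.induction_linear with
      | zero => simp
      | add y y' hy hy' => simp only [map_add, hy, hy', mul_add]
      | single q z' =>
        simp [sesquilinearOfMatrix_single_single, Finsupp.mapDomain_single, hρ, mul_smul_comm]

/-! ### Operators on right Hilbert modules -/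

section RightInner

variable {B : Type*} [NonUnitalCStarAlgebra B] [PartialOrder B]
variable {E : Type*} [NormedAddCommGroup E] [NormedSpace ℂ E] [SMul Bᵐᵒᵖ E] [CStarModule Bᵐᵒᵖ E]

theorem rightInner_add_right (x y z : E) :
    rightInner B x (y + z) = rightInner B x y + rightInner B x z := by simp [rightInner]

theorem rightInner_sub_right (x y z : E) :
    rightInner B x (y - z) = rightInner B x y - rightInner B x z := by simp [rightInner]

theorem rightInner_sub_left (x y z : E) :
    rightInner B (x - y) z = rightInner B x z - rightInner B y z := by simp [rightInner]

theorem rightInner_smul_right (c : ℂ) (x y : E) :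
    rightInner B x (c • y) = c • rightInner B x y := by simp [rightInner]

theorem rightInner_smul_left (c : ℂ) (x y : E) :
    rightInner B (c • x) y = star c • rightInner B x y := by simp [rightInner]

theorem rightInner_add_left (x y z : E) :
    rightInner B (x + y) z = rightInner B x z + rightInner B y z := by simp [rightInner]

theorem rightInner_sum_left {ι : Type*} (s : Finset ι) (f : ι → E) (x : E) :
    rightInner B (∑ i ∈ s, f i) x = ∑ i ∈ s, rightInner B (f i) x := by simp [rightInner]

theorem rightInner_sum_right {ι : Type*} (s : Finset ι) (x : E) (f : ι → E) :
    rightInner B x (∑ i ∈ s, f i) = ∑ i ∈ s, rightInner B x (f i) := by simp [rightInner]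

variable (B) in
theorem norm_sq_eq_norm_rightInner (x : E) : ‖x‖ ^ 2 = ‖rightInner B x x‖ :=
  CStarModule.norm_sq_eq Bᵐᵒᵖ

theorem Adjointable.ext_of_dense {F : Type*} [NormedAddCommGroup F] [NormedSpace ℂ F]
    [SMul Bᵐᵒᵖ F] [CStarModule Bᵐᵒᵖ F] {s : Set E} (hs : Dense (Submodule.span ℂ s : Set E))
    {T R : Adjointable B E F} (h : ∀ x ∈ s, T x = R x) : T = R :=
  Subtype.ext (ContinuousLinearMap.ext_on hs h)

variable [StarOrderedRing B]

theorem norm_rightInner_le (x y : E) : ‖rightInner B x y‖ ≤ ‖x‖ * ‖y‖ :=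
  CStarModule.norm_inner_le E (A := Bᵐᵒᵖ)

variable (B) in
theorem continuous_rightInner : Continuous fun p : E × E => rightInner B p.1 p.2 :=
  MulOpposite.continuous_unop.comp CStarModule.continuous_inner

variable (B) in
theorem tendsto_rightInner {ι : Type*} {l : Filter ι} {f g : ι → E} {x y : E}
    (hf : Tendsto f l (𝓝 x)) (hg : Tendsto g l (𝓝 y)) :
    Tendsto (fun i => rightInner B (f i) (g i)) l (𝓝 (rightInner B x y)) :=
  ((continuous_rightInner B).tendsto (x, y)).comp (hf.prodMk_nhds hg)

theorem rightInner_apply_eq_of_dense {F : Type*} [NormedAddCommGroup F] [NormedSpace ℂ F]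
    [SMul Bᵐᵒᵖ F] [CStarModule Bᵐᵒᵖ F] (T : E →L[ℂ] F) {s : Set E}
    (hs : Dense (Submodule.span ℂ s : Set E)) {y : F} {z : E}
    (h : ∀ x ∈ s, rightInner B y (T x) = rightInner B z x) (x : E) :
    rightInner B y (T x) = rightInner B z x := by
  have hinner : (CStarModule.innerSL (A := Bᵐᵒᵖ) y).comp T = CStarModule.innerSL z :=
    ContinuousLinearMap.ext_on hs fun x hx => MulOpposite.unop_injective (h x hx)
  exact congrArg MulOpposite.unop (DFunLike.congr_fun hinner x)

variable (B) in
theorem eq_of_forall_rightInner_eq {s : Set E} (hs : Dense (Submodule.span ℂ s : Set E)) {x y : E}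
    (h : ∀ z ∈ s, rightInner B z x = rightInner B z y) : x = y :=
  rightInner_left_injective B fun z => by
    rw [← star_rightInner, ← star_rightInner B y]
    congr 1
    refine rightInner_apply_eq_of_dense (.id ℂ E) hs (fun z hz => ?_) z
    rw [ContinuousLinearMap.id_apply, ← star_rightInner, h z hz, star_rightInner]

end RightInner

section Orbit

variable {B : Type*} [NonUnitalCStarAlgebra B] [PartialOrder B] [StarOrderedRing B]
variable {E : Type*} [NormedAddCommGroup E] [NormedSpace ℂ E] [SMul Bᵐᵒᵖ E] [CStarModule Bᵐᵒᵖ E]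

theorem exists_star_mul_self_eq_algebraMap_norm_sq_sub {D : Type*} [CStarAlgebra D] (a : D) :
    ∃ d : D, star d * d = algebraMap ℝ D (‖a‖ ^ 2) - star a * a := by
  let := CStarAlgebra.spectralOrder D
  let := CStarAlgebra.spectralOrderedRing D
  obtain ⟨d, hd⟩ := CStarAlgebra.nonneg_iff_eq_star_mul_self.1
    (sub_nonneg.2 (CStarAlgebra.star_mul_le_algebraMap_norm_sq (a := a)))
  exact ⟨d, hd.symm⟩

theorem norm_apply_le_of_rightInner_apply_apply {D : Type*} [CStarAlgebra D] (y : D →ₗ[ℂ] E)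
    (hy : ∀ a b, rightInner B (y a) (y b) = rightInner B (y 1) (y (star a * b))) (a : D) :
    ‖y a‖ ≤ ‖a‖ * ‖y 1‖ := by
  obtain ⟨d, hd⟩ := exists_star_mul_self_eq_algebraMap_norm_sq_sub a
  have hscalar : algebraMap ℝ D (‖a‖ ^ 2) = ((‖a‖ ^ 2 : ℝ) : ℂ) • 1 := by
    rw [Complex.coe_smul, Algebra.algebraMap_eq_smul_one]
  have hle : rightInner B (y a) (y a) ≤ (‖a‖ ^ 2 : ℝ) • rightInner B (y 1) (y 1) := by
    rw [← sub_nonneg]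
    convert rightInner_self_nonneg B (y d) using 1
    rw [hy d, hd, hscalar, map_sub, map_smul, rightInner_sub_right, rightInner_smul_right, ← hy,
      Complex.coe_smul]
  have hnorm := CStarAlgebra.norm_le_norm_of_nonneg_of_le (rightInner_self_nonneg B _) hle
  rw [norm_smul, Real.norm_of_nonneg (by positivity), ← norm_sq_eq_norm_rightInner,
    ← norm_sq_eq_norm_rightInner, ← mul_pow] at hnorm
  exact (sq_le_sq₀ (norm_nonneg _) (by positivity)).1 hnorm

theorem norm_apply_le_of_rightInner_orbit {A : Type*} [NonUnitalCStarAlgebra A] (x : E)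
    (y : A →ₗ[ℂ] E)
    (hy : ∀ a b, rightInner B (y a) (y b) = rightInner B x (y (star a * b)))
    (hx : ∀ a, rightInner B (y a) x = rightInner B x (y (star a))) (a : A) :
    ‖y a‖ ≤ ‖a‖ * ‖x‖ := by
  let y' : Unitization ℂ A →ₗ[ℂ] E :=
    { toFun u := u.fst • x + y u.snd
      map_add' u u' := by simp only [Unitization.fst_add, Unitization.snd_add, map_add]; module
      map_smul' c u := by
        simp only [Unitization.fst_smul, Unitization.snd_smul, map_smul, RingHom.id_apply,
          smul_eq_mul]
        module }
  have hy' (u w : Unitization ℂ A) :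
      rightInner B (y' u) (y' w) = rightInner B (y' 1) (y' (star u * w)) := by
    simp only [y', LinearMap.coe_mk, AddHom.coe_mk, Unitization.fst_one, Unitization.snd_one,
      Unitization.fst_mul, Unitization.snd_mul, Unitization.fst_star, Unitization.snd_star,
      one_smul, map_zero, add_zero, map_add, map_smul, rightInner_add_left, rightInner_add_right,
      rightInner_smul_left, rightInner_smul_right, hy, hx]
    module
  simpa [y', Unitization.norm_inr] using norm_apply_le_of_rightInner_apply_apply (B := B) y' hy' a

end Orbit

section DenseFamily

variable {P E X : Type*} [NormedAddCommGroup E] [NormedSpace ℂ E]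
  [NormedAddCommGroup X] [NormedSpace ℂ X]

theorem exists_continuousLinearMap_apply_eq [CompleteSpace X] {v : P → E} {w : P → X}
    (hv : Dense (Submodule.span ℂ (Set.range v) : Set E)) {M : ℝ}
    (hM : ∀ c : P →₀ ℂ,
      ‖Finsupp.linearCombination ℂ w c‖ ≤ M * ‖Finsupp.linearCombination ℂ v c‖) :
    ∃ T : E →L[ℂ] X, ∀ p, T (v p) = w p := by
  have hdense : DenseRange (Finsupp.linearCombination ℂ v) := by
    rwa [DenseRange, ← LinearMap.coe_range, Finsupp.range_linearCombination]
  refine ⟨(Finsupp.linearCombination ℂ w).extendOfNorm (Finsupp.linearCombination ℂ v),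
    fun p => ?_⟩
  simpa using LinearMap.extendOfNorm_eq hdense ⟨M, hM⟩ (.single p 1)

end DenseFamily

section DenseFamilyHilbertModule

variable {B : Type*} [NonUnitalCStarAlgebra B] [PartialOrder B] [StarOrderedRing B]
variable {P E F : Type*}
  [NormedAddCommGroup E] [NormedSpace ℂ E] [SMul Bᵐᵒᵖ E] [CStarModule Bᵐᵒᵖ E]
  [NormedAddCommGroup F] [NormedSpace ℂ F] [SMul Bᵐᵒᵖ F] [CStarModule Bᵐᵒᵖ F]

theorem mem_adjointableSubmodule_of_dense [CompleteSpace F] (T : F →L[ℂ] E) {v : P → E}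
    (hv : Dense (Submodule.span ℂ (Set.range v) : Set E)) {w : P → F}
    (hT : ∀ x p, rightInner B (v p) (T x) = rightInner B (w p) x) :
    T ∈ adjointableSubmodule B F E := by
  have hlc (x : F) (c : P →₀ ℂ) : rightInner B (Finsupp.linearCombination ℂ v c) (T x) =
      rightInner B (Finsupp.linearCombination ℂ w c) x := by
    simp only [Finsupp.linearCombination_apply, Finsupp.sum, rightInner_sum_left,
      rightInner_smul_left, hT]
  have hbound (c : P →₀ ℂ) : ‖Finsupp.linearCombination ℂ w c‖ ≤
      ‖T‖ * ‖Finsupp.linearCombination ℂ v c‖ := by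
    set x := Finsupp.linearCombination ℂ w c
    have hsq : ‖x‖ * ‖x‖ ≤ ‖x‖ * (‖T‖ * ‖Finsupp.linearCombination ℂ v c‖) := by
      calc ‖x‖ * ‖x‖ = ‖rightInner B (Finsupp.linearCombination ℂ v c) (T x)‖ := by
            rw [hlc, ← sq, norm_sq_eq_norm_rightInner B]
        _ ≤ ‖Finsupp.linearCombination ℂ v c‖ * (‖T‖ * ‖x‖) :=
            (norm_rightInner_le _ _).trans (by gcongr; exact T.le_opNorm x)
        _ = ‖x‖ * (‖T‖ * ‖Finsupp.linearCombination ℂ v c‖) := by ring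
    rcases (norm_nonneg x).eq_or_lt' with hx | hx
    · rw [hx]; positivity
    · exact le_of_mul_le_mul_left hsq hx
  obtain ⟨T', hT'⟩ := exists_continuousLinearMap_apply_eq hv hbound
  refine ⟨T', fun x y => (rightInner_apply_eq_of_dense T' hv ?_ y).symm⟩
  rintro _ ⟨p, rfl⟩
  rw [hT', ← star_rightInner, ← hT, star_rightInner]

theorem existsUnique_isUnitary_apply_eq [CompleteSpace E] [CompleteSpace F]
    {v : P → E} {w : P → F}
    (hv : Dense (Submodule.span ℂ (Set.range v) : Set E))
    (hw : Dense (Submodule.span ℂ (Set.range w) : Set F))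
    (hvw : ∀ p q, rightInner B (v p) (v q) = rightInner B (w p) (w q)) :
    ∃! U : Adjointable B E F, U.IsUnitary ∧ ∀ p, U (v p) = w p := by
  have hnorm (c : P →₀ ℂ) : ‖Finsupp.linearCombination ℂ w c‖ ≤
      1 * ‖Finsupp.linearCombination ℂ v c‖ := by
    rw [one_mul, ← sq_le_sq₀ (norm_nonneg _) (norm_nonneg _), norm_sq_eq_norm_rightInner B,
      norm_sq_eq_norm_rightInner B]
    simp only [Finsupp.linearCombination_apply, Finsupp.sum, rightInner_sum_left,
      rightInner_smul_left, rightInner_sum_right, rightInner_smul_right, hvw, le_refl]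
  obtain ⟨T, hT⟩ := exists_continuousLinearMap_apply_eq hv hnorm
  have hinner (x : E) (q : P) : rightInner B (w q) (T x) = rightInner B (v q) x := by
    refine rightInner_apply_eq_of_dense T hv ?_ x
    rintro _ ⟨p, rfl⟩
    rw [hT, hvw]
  let U : Adjointable B E F := ⟨T, mem_adjointableSubmodule_of_dense T hw hinner⟩
  have hU (p : P) : U (v p) = w p := hT p
  have hadjoint (p : P) : U.adjoint (w p) = v p := by
    refine eq_of_forall_rightInner_eq B hv ?_
    rintro _ ⟨q, rfl⟩
    rw [Adjointable.rightInner_adjoint_right, hU, hvw]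
  refine ⟨U, ⟨⟨Adjointable.ext_of_dense hv ?_, Adjointable.ext_of_dense hw ?_⟩, hU⟩,
    fun V hV => Adjointable.ext_of_dense hv ?_⟩
  · rintro _ ⟨p, rfl⟩
    exact (congrArg _ (hU p)).trans (hadjoint p)
  · rintro _ ⟨p, rfl⟩
    exact (congrArg _ (hadjoint p)).trans (hU p)
  · rintro _ ⟨p, rfl⟩
    rw [hV.2, hU]

end DenseFamilyHilbertModule

section Representation

variable {A B E : Type*} [NonUnitalCStarAlgebra A] [NonUnitalCStarAlgebra B] [PartialOrder B]
  [NormedAddCommGroup E] [NormedSpace ℂ E] [SMul Bᵐᵒᵖ E] [CStarModule Bᵐᵒᵖ E]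

theorem rightInner_starAlgHom_apply_right (φ : A →⋆ₙₐ[ℂ] Adjointable B E E) (a : A) (x y : E) :
    rightInner B x (φ a y) = rightInner B (φ (star a) x) y := by
  rw [map_star]
  exact (Adjointable.rightInner_adjoint_left (φ a) y x).symm

theorem starAlgHom_mul_apply (φ : A →⋆ₙₐ[ℂ] Adjointable B E E) (a b : A) (x : E) :
    φ (a * b) x = φ a (φ b x) := by
  rw [map_mul]
  rfl

variable [StarOrderedRing B]

theorem eq_of_forall_starAlgHom_apply_eq {φ : A →⋆ₙₐ[ℂ] Adjointable B E E}
    (hφ : Dense (Submodule.span ℂ {x : E | ∃ a y, x = φ a y} : Set E)) {x y : E}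
    (h : ∀ a, φ a x = φ a y) : x = y := by
  refine eq_of_forall_rightInner_eq B hφ ?_
  rintro _ ⟨a, z, rfl⟩
  rw [← star_star a, ← rightInner_starAlgHom_apply_right, h, rightInner_starAlgHom_apply_right]

theorem norm_starAlgHom_apply_le (φ : A →⋆ₙₐ[ℂ] Adjointable B E E) (a : A) (x : E) :
    ‖φ a x‖ ≤ ‖a‖ * ‖x‖ := by
  let orbit : A →ₗ[ℂ] E :=
    { toFun b := φ b x
      map_add' b c := by rw [map_add]; rfl
      map_smul' c b := by rw [map_smul]; rfl }
  refine norm_apply_le_of_rightInner_orbit (B := B) x orbit (fun b c => ?_) (fun b => ?_) a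
  · change rightInner B (φ b x) (φ c x) = rightInner B x (φ (star b * c) x)
    rw [starAlgHom_mul_apply, rightInner_starAlgHom_apply_right φ (star b), star_star]
  · change rightInner B (φ b x) x = rightInner B x (φ (star b) x)
    rw [rightInner_starAlgHom_apply_right, star_star]

theorem lipschitzWith_starAlgHom_apply (φ : A →⋆ₙₐ[ℂ] Adjointable B E E) (a : A) :
    LipschitzWith ‖a‖₊ (φ a) :=
  .of_dist_le_mul fun x y => by
    rw [dist_eq_norm, dist_eq_norm, ← map_sub]
    exact norm_starAlgHom_apply_le φ a _

theorem continuous_starAlgHom_apply (φ : A →⋆ₙₐ[ℂ] Adjointable B E E) (x : E) :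
    Continuous fun a => φ a x :=
  LipschitzWith.continuous (K := ‖x‖₊) <| .of_dist_le_mul fun a b => by
    rw [dist_eq_norm, dist_eq_norm, mul_comm]
    refine le_trans (le_of_eq ?_) (norm_starAlgHom_apply_le φ (a - b) x)
    rw [map_sub]
    rfl

theorem tendsto_starAlgHom_apply [PartialOrder A] [StarOrderedRing A]
    {φ : A →⋆ₙₐ[ℂ] Adjointable B E E}
    (hφ : Dense (Submodule.span ℂ {x : E | ∃ a y, x = φ a y} : Set E)) {l : Filter A}
    (hl : l.IsIncreasingApproximateUnit) (x : E) : Tendsto (fun e => φ e x) l (𝓝 x) := by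
  let F (e : Metric.closedBall (0 : A) 1) (x : E) : E := φ e x
  have hF : Equicontinuous F := (LipschitzWith.uniformEquicontinuous F 1 fun e =>
    (lipschitzWith_starAlgHom_apply φ e).weaken (mem_closedBall_zero_iff.1 e.2)).equicontinuous
  have hball : Set.range (Subtype.val : Metric.closedBall (0 : A) 1 → A) ∈ l := by
    simpa [Filter.Eventually] using hl.eventually_norm
  rw [← tendsto_comap'_iff hball]
  induction x using hφ.induction with
  | mem x hx =>
    refine Tendsto.comp (?_ : Tendsto (fun e => φ e x) l (𝓝 x)) tendsto_comap
    induction hx using Submodule.span_induction with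
    | mem x hx =>
      obtain ⟨a, y, rfl⟩ := hx
      simp only [← starAlgHom_mul_apply]
      exact ((continuous_starAlgHom_apply φ y).tendsto a).comp (hl.tendsto_mul_right a)
    | zero => simpa using tendsto_const_nhds
    | add y z _ _ hy hz => simpa using hy.add hz
    | smul c y _ hy => simpa using hy.const_smul c
  | isClosed => exact hF.isClosed_setOfPred_tendsto continuous_id

end Representation

theorem exists_tendsto_of_dist_le {X E : Type*} [PseudoMetricSpace E] [CompleteSpace E]
    {l : Filter X} [l.NeBot] {f : X → E} {b : X → X → ℝ} {c : X → ℝ}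
    (hf : ∀ᶠ y in l, ∀ᶠ x in l, dist (f x) (f y) ≤ b x y)
    (hb : ∀ y, Tendsto (b · y) l (𝓝 (c y))) (hc : Tendsto c l (𝓝 0)) :
    ∃ z, Tendsto f l (𝓝 z) := by
  refine cauchy_map_iff_exists_tendsto.1 (Metric.cauchy_iff.2 ⟨inferInstance, fun ε hε => ?_⟩)
  obtain ⟨y, hy, hfy⟩ := ((hc.eventually_lt_const (half_pos hε)).and hf).exists
  refine ⟨Metric.ball (f y) (ε / 2), ?_, fun z hz z' hz' => ?_⟩
  · rw [mem_map]
    filter_upwards [hfy, (hb y).eventually_lt_const hy] with x hx hbx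
    exact hx.trans_lt hbx
  · have := dist_triangle_right z z' (f y)
    rw [Metric.mem_ball] at hz hz'
    linarith

theorem exists_norm_adjointable_apply_le {A B F : Type*} [NonUnitalCStarAlgebra A]
    [NonUnitalCStarAlgebra B] [PartialOrder B]
    [NormedAddCommGroup F] [NormedSpace ℂ F] [SMul Bᵐᵒᵖ F] [CStarModule Bᵐᵒᵖ F]
    (T : A →L[ℂ] Adjointable B F F) : ∃ M, 0 ≤ M ∧ ∀ a η, ‖T a η‖ ≤ M * ‖a‖ * ‖η‖ := by
  let T' : A →L[ℂ] F →L[ℂ] F := (adjointableSubmodule B F F).subtypeL ∘L T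
  exact ⟨‖T'‖, norm_nonneg T', T'.le_opNorm₂⟩

section MatrixCoefficient

variable {A B F : Type*} [NonUnitalCStarAlgebra A]
  [NonUnitalCStarAlgebra B] [PartialOrder B] [StarOrderedRing B]
  [NormedAddCommGroup F] [NormedSpace ℂ F] [SMul Bᵐᵒᵖ F] [CStarModule Bᵐᵒᵖ F]

/-- The matrix coefficient `a ↦ ⟨ξ, T(a) η⟩` of a bounded linear map `T : A → 𝓛(F)`. -/
noncomputable def matrixCoefficient (T : A →L[ℂ] Adjointable B F F) (ξ η : F) : A →L[ℂ] B :=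
  ((MulOpposite.opContinuousLinearEquiv ℂ (M := B)).symm : Bᵐᵒᵖ →L[ℂ] B) ∘L CStarModule.innerSL ξ ∘L
    ContinuousLinearMap.apply ℂ F η ∘L (adjointableSubmodule B F F).subtypeL ∘L T

theorem matrixCoefficient_apply (T : A →L[ℂ] Adjointable B F F) (ξ η : F) (a : A) :
    matrixCoefficient T ξ η a = rightInner B ξ (T a η) := rfl

end MatrixCoefficient

theorem mul_self_le_self_of_norm_le_one {A : Type*} [NonUnitalCStarAlgebra A]
    [PartialOrder A] [StarOrderedRing A] {e : A} (he : 0 ≤ e) (he1 : ‖e‖ ≤ 1) : e * e ≤ e := by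
  obtain ⟨c, rfl⟩ := CStarAlgebra.nonneg_iff_eq_star_mul_self.1 he
  have hc : ‖c * star c‖ ≤ 1 := by
    rwa [CStarRing.norm_self_mul_star, ← CStarRing.norm_star_mul_self]
  calc star c * c * (star c * c) = star c * (c * star c) * c := by simp only [mul_assoc]
    _ ≤ ‖c * star c‖ • (star c * c) :=
        CStarAlgebra.star_left_conjugate_le_norm_smul (.of_nonneg (mul_star_self_nonneg c))
    _ ≤ star c * c := smul_le_of_le_one_left (star_mul_self_nonneg c) hc

/-! ### Kolmogorov families of kernels -/

section Kernels

variable {S A B F : Type*} [NonUnitalCStarAlgebra A] [NonUnitalCStarAlgebra B] [PartialOrder B]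
variable [NormedAddCommGroup F] [NormedSpace ℂ F] [SMul Bᵐᵒᵖ F] [CStarModule Bᵐᵒᵖ F]

theorem Adjointable.map_smul_op {E : Type*} [NormedAddCommGroup E] [NormedSpace ℂ E]
    [SMul Bᵐᵒᵖ E] [CStarModule Bᵐᵒᵖ E] (T : Adjointable B F E) (c : Bᵐᵒᵖ) (ξ : F) :
    T (c • ξ) = c • T ξ :=
  rightInner_left_injective B fun z => by
    rw [← MulOpposite.op_unop c, rightInner_op_smul_right, ← rightInner_adjoint_left,
      rightInner_op_smul_right, rightInner_adjoint_left]

theorem IsPositiveDefiniteKernel.sum_nonneg {k : S → S → A →L[ℂ] Adjointable B F F}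
    (hk : IsPositiveDefiniteKernel k) {ι : Type*} (I : Finset ι) (s : ι → S) (a : ι → A)
    (ξ : ι → F) :
    0 ≤ ∑ i ∈ I, ∑ j ∈ I, rightInner B (ξ i) (k (s i) (s j) (star (a i) * a j) (ξ j)) := by
  have hsum (f : ι → B) : ∑ i ∈ I, f i = ∑ i, f (I.equivFin.symm i) := by
    rw [← Finset.sum_coe_sort, ← I.equivFin.symm.sum_comp]
  simp only [hsum]
  exact hk I.card _ _ _

end Kernels

/-- A Kolmogorov family of the kernel `k`: a linearly dense family of vectors with the Gram matrix
of the elementary tensors `a ⊗ s ⊗ ξ`.  In terms of a minimal pair `(ζ, E)` these are the vectors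
`φ_E(a) ζ(s) ξ`. -/
structure IsKolmogorovFamily {S A B F E : Type*} [NonUnitalCStarAlgebra A]
    [NonUnitalCStarAlgebra B] [PartialOrder B]
    [NormedAddCommGroup F] [NormedSpace ℂ F] [SMul Bᵐᵒᵖ F] [CStarModule Bᵐᵒᵖ F]
    [NormedAddCommGroup E] [NormedSpace ℂ E] [SMul Bᵐᵒᵖ E] [CStarModule Bᵐᵒᵖ E]
    (k : S → S → A →L[ℂ] Adjointable B F F) (v : A × S × F → E) : Prop where
  rightInner_apply a s ξ b t η :
    rightInner B (v (a, s, ξ)) (v (b, t, η)) = rightInner B ξ (k s t (star a * b) η)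
  dense_span : Dense (Submodule.span ℂ (Set.range v) : Set E)

theorem IsPositiveDefiniteKernel.exists_isKolmogorovFamily
    {A : Type u} [NonUnitalCStarAlgebra A]
    {B : Type v} [NonUnitalCStarAlgebra B] [PartialOrder B] [StarOrderedRing B]
    {F : Type w} [NormedAddCommGroup F] [NormedSpace ℂ F]
    [SMul Bᵐᵒᵖ F] [CStarModule Bᵐᵒᵖ F]
    {S : Type x} {k : S → S → A →L[ℂ] Adjointable B F F} (hk : IsPositiveDefiniteKernel k) :
    ∃ (E : Type (max u w x y)) (_ : NormedAddCommGroup E) (_ : NormedSpace ℂ E)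
      (_ : CompleteSpace E) (_ : SMul Bᵐᵒᵖ E) (_ : CStarModule Bᵐᵒᵖ E) (v : A × S × F → E),
      IsKolmogorovFamily k v := by
  let P : Type (max u w x y) := ULift.{y} (A × S × F)
  let gram (p q : P) : Bᵐᵒᵖ :=
    inner Bᵐᵒᵖ p.down.2.2 (k p.down.2.1 q.down.2.1 (star p.down.1 * q.down.1) q.down.2.2)
  have gram_nonneg (f : P →₀ ℂ) : 0 ≤ sesquilinearOfMatrix gram f f := by
    rw [sesquilinearOfMatrix_self, ← MulOpposite.unop_nonneg]
    convert hk.sum_nonneg f.support (fun p => p.down.2.1) (fun p => f p • p.down.1)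
      (fun p => p.down.2.2) using 1
    simp only [gram, rightInner, Finset.unop_sum, MulOpposite.unop_smul, star_smul,
      smul_mul_smul_comm, map_smul, SetLike.val_smul, smul_apply,
      CStarModule.inner_smul_right_complex]
  let H := PreHilbertModule.ofMatrix gram
    (fun c p => ⟨p.down.1, p.down.2.1, c • p.down.2.2⟩) gram_nonneg
    fun c p q => by simp only [gram, Adjointable.map_smul_op, CStarModule.inner_op_smul_right]
  refine ⟨UniformSpace.Completion H.Space, inferInstance, inferInstance, inferInstance,
    inferInstance, inferInstance,
    fun p => H.toCompletion (Finsupp.single ⟨p⟩ 1), ⟨fun a s ξ b t η => ?_, ?_⟩⟩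
  · rw [rightInner, H.inner_toCompletion]
    simp [H, PreHilbertModule.ofMatrix, sesquilinearOfMatrix_single_single, gram, rightInner]
  · refine H.denseRange_toCompletion.mono ?_
    rintro _ ⟨f, rfl⟩
    change H.toCompletion f ∈ Submodule.span ℂ _
    induction f using Finsupp.induction_linear with
    | zero => exact map_zero H.toCompletion ▸ zero_mem _
    | add f g hf hg => exact map_add H.toCompletion f g ▸ add_mem hf hg
    | single p c =>
      rw [← mul_one c, ← smul_eq_mul, ← Finsupp.smul_single, map_smul]
      exact Submodule.smul_mem _ c (Submodule.subset_span ⟨p.down, rfl⟩)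

namespace IsKolmogorovFamily

variable {S A B F E : Type*} [NonUnitalCStarAlgebra A]
  [NonUnitalCStarAlgebra B] [PartialOrder B]
  [NormedAddCommGroup F] [NormedSpace ℂ F] [SMul Bᵐᵒᵖ F] [CStarModule Bᵐᵒᵖ F]
  [NormedAddCommGroup E] [NormedSpace ℂ E] [SMul Bᵐᵒᵖ E] [CStarModule Bᵐᵒᵖ E]
  {k : S → S → A →L[ℂ] Adjointable B F F} {v : A × S × F → E}

theorem rightInner_mul_left (hv : IsKolmogorovFamily k v) (a : A) (p q : A × S × F) :
    rightInner B (v (a * p.1, p.2)) (v q) = rightInner B (v p) (v (star a * q.1, q.2)) := by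
  rw [hv.rightInner_apply, hv.rightInner_apply, star_mul, mul_assoc]

variable [StarOrderedRing B]

section LeftAction

theorem apply_add_left (hv : IsKolmogorovFamily k v) (a b : A) (p : S × F) :
    v (a + b, p) = v (a, p) + v (b, p) := by
  refine eq_of_forall_rightInner_eq B hv.dense_span ?_
  rintro _ ⟨q, rfl⟩
  simp only [hv.rightInner_apply, rightInner_add_right, mul_add, map_add, Submodule.coe_add,
    add_apply]

theorem apply_smul_left (hv : IsKolmogorovFamily k v) (c : ℂ) (a : A) (p : S × F) :
    v (c • a, p) = c • v (a, p) := by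
  refine eq_of_forall_rightInner_eq B hv.dense_span ?_
  rintro _ ⟨q, rfl⟩
  simp only [hv.rightInner_apply, rightInner_smul_right, mul_smul_comm, map_smul,
    Submodule.coe_smul, smul_apply]

theorem norm_linearCombination_mul_le (hv : IsKolmogorovFamily k v) (a : A)
    (c : A × S × F →₀ ℂ) :
    ‖Finsupp.linearCombination ℂ (fun p => v (a * p.1, p.2)) c‖ ≤
      ‖a‖ * ‖Finsupp.linearCombination ℂ v c‖ := by
  let orbit : A →ₗ[ℂ] E :=
    { toFun b := Finsupp.linearCombination ℂ (fun p => v (b * p.1, p.2)) c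
      map_add' b b' := by
        simp only [Finsupp.linearCombination_apply, add_mul, hv.apply_add_left, smul_add,
          Finsupp.sum_add]
      map_smul' z b := by
        simp only [Finsupp.linearCombination_apply, smul_mul_assoc, hv.apply_smul_left,
          smul_comm _ z, Finsupp.smul_sum, RingHom.id_apply] }
  refine norm_apply_le_of_rightInner_orbit (B := B) _ orbit (fun b b' => ?_) (fun b => ?_) a <;>
    simp only [orbit, LinearMap.coe_mk, AddHom.coe_mk, Finsupp.linearCombination_apply,
      Finsupp.sum, rightInner_sum_left, rightInner_sum_right, rightInner_smul_left,
      rightInner_smul_right, hv.rightInner_mul_left, mul_assoc]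

variable [CompleteSpace E]

theorem exists_adjointable_apply_mul (hv : IsKolmogorovFamily k v) (a : A) :
    ∃ T : Adjointable B E E, ∀ p, T (v p) = v (a * p.1, p.2) := by
  obtain ⟨T, hT⟩ := exists_continuousLinearMap_apply_eq hv.dense_span
    (hv.norm_linearCombination_mul_le a)
  refine ⟨⟨T, mem_adjointableSubmodule_of_dense T hv.dense_span
    (w := fun q => v (star a * q.1, q.2)) fun x q => ?_⟩, hT⟩
  refine rightInner_apply_eq_of_dense T hv.dense_span ?_ x
  rintro _ ⟨p, rfl⟩
  rw [hT, hv.rightInner_mul_left, star_star]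

theorem exists_leftAction (hv : IsKolmogorovFamily k v) :
    ∃ φ : A →⋆ₙₐ[ℂ] Adjointable B E E, ∀ a p, φ a (v p) = v (a * p.1, p.2) := by
  choose T hT using hv.exists_adjointable_apply_mul
  have ext {R R' : Adjointable B E E} (h : ∀ p, R (v p) = R' (v p)) : R = R' :=
    Adjointable.ext_of_dense hv.dense_span (Set.forall_mem_range.2 h)
  let φ : A →⋆ₙₐ[ℂ] Adjointable B E E :=
    { toFun := T
      map_smul' c a := ext fun p => by
        change T (c • a) (v p) = c • T a (v p)
        rw [hT, hT, smul_mul_assoc, hv.apply_smul_left]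
      map_zero' := ext fun p => by
        change T 0 (v p) = 0
        rw [hT, zero_mul, ← zero_smul ℂ (0 : A), hv.apply_smul_left, zero_smul]
      map_add' a b := ext fun p => by
        change T (a + b) (v p) = T a (v p) + T b (v p)
        rw [hT, hT, hT, add_mul, hv.apply_add_left]
      map_mul' a b := ext fun p => by
        change T (a * b) (v p) = T a (T b (v p))
        rw [hT, hT, hT, mul_assoc]
      map_star' a := ext fun p => by
        change T (star a) (v p) = (T a).adjoint (v p)
        refine eq_of_forall_rightInner_eq B hv.dense_span (Set.forall_mem_range.2 fun q => ?_)
        rw [hT, Adjointable.rightInner_adjoint_right, hT, hv.rightInner_mul_left] }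
  exact ⟨φ, hT⟩

end LeftAction

theorem starAlgHom_apply_eq (hv : IsKolmogorovFamily k v)
    {φ : A →⋆ₙₐ[ℂ] Adjointable B E E} {ζ : S → Adjointable B F E}
    (hφ : ∀ a p, φ a (v p) = v (a * p.1, p.2))
    (hζ : ∀ s q ξ, rightInner B (v q) (ζ s ξ) = rightInner B (k s q.2.1 q.1 q.2.2) ξ)
    (a : A) (s : S) (ξ : F) : φ a (ζ s ξ) = v (a, s, ξ) := by
  refine eq_of_forall_rightInner_eq B hv.dense_span ?_
  rintro _ ⟨⟨b, t, η⟩, rfl⟩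
  rw [rightInner_starAlgHom_apply_right, hφ, hζ, ← star_rightInner, ← hv.rightInner_apply,
    star_rightInner]

theorem exists_norm_apply_le (hv : IsKolmogorovFamily k v) (s : S) :
    ∃ M, 0 ≤ M ∧ ∀ a ξ, ‖v (a, s, ξ)‖ ≤ M * ‖a‖ * ‖ξ‖ := by
  obtain ⟨M, hM0, hM⟩ := exists_norm_adjointable_apply_le (k s s)
  refine ⟨√M, Real.sqrt_nonneg M, fun a ξ => (sq_le_sq₀ (norm_nonneg _) (by positivity)).1 ?_⟩
  calc ‖v (a, s, ξ)‖ ^ 2 = ‖rightInner B ξ (k s s (star a * a) ξ)‖ := by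
        rw [norm_sq_eq_norm_rightInner B, hv.rightInner_apply]
    _ ≤ ‖ξ‖ * (M * ‖star a * a‖ * ‖ξ‖) :=
        (norm_rightInner_le _ _).trans (by gcongr; exact hM _ _)
    _ = (√M * ‖a‖ * ‖ξ‖) ^ 2 := by
        rw [CStarRing.norm_star_mul_self, mul_pow, mul_pow, Real.sq_sqrt hM0]; ring

variable [PartialOrder A] [StarOrderedRing A]

theorem matrixCoefficient_nonneg (hv : IsKolmogorovFamily k v) (s : S) (ξ : F) {a : A}
    (ha : 0 ≤ a) : 0 ≤ matrixCoefficient (k s s) ξ ξ a := by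
  obtain ⟨c, rfl⟩ := CStarAlgebra.nonneg_iff_eq_star_mul_self.1 ha
  rw [matrixCoefficient_apply, ← hv.rightInner_apply]
  exact rightInner_self_nonneg B _

theorem norm_sub_sq_le (hv : IsKolmogorovFamily k v) (s : S) (ξ : F) {e e' : A}
    (he : 0 ≤ e) (he1 : ‖e‖ ≤ 1) (he' : 0 ≤ e') (he1' : ‖e'‖ ≤ 1) :
    ‖v (e, s, ξ) - v (e', s, ξ)‖ ^ 2 ≤
      ‖matrixCoefficient (k s s) ξ ξ (e - e * e' - e' * e + e')‖ := by
  rw [norm_sq_eq_norm_rightInner B]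
  refine CStarAlgebra.norm_le_norm_of_nonneg_of_le (rightInner_self_nonneg B _) ?_
  have hle := hv.matrixCoefficient_nonneg s ξ <| add_nonneg
    (sub_nonneg.2 (mul_self_le_self_of_norm_le_one he he1))
    (sub_nonneg.2 (mul_self_le_self_of_norm_le_one he' he1'))
  rw [← sub_nonneg]
  convert hle using 1
  simp only [rightInner_sub_left, rightInner_sub_right, hv.rightInner_apply, map_add, map_sub,
    (IsSelfAdjoint.of_nonneg he).star_eq, (IsSelfAdjoint.of_nonneg he').star_eq,
    ← matrixCoefficient_apply]
  abel

theorem exists_tendsto_apply [CompleteSpace E] (hv : IsKolmogorovFamily k v) {l : Filter A}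
    (hl : l.IsIncreasingApproximateUnit) {s : S} (hs : IsStrictAlong (k s s) l) (ξ : F) :
    ∃ z, Tendsto (fun e => v (e, s, ξ)) l (𝓝 z) := by
  obtain ⟨R, hR, -⟩ := hs
  have := hl.neBot
  set ω := matrixCoefficient (k s s) ξ ξ
  have hω : Tendsto ω l (𝓝 (rightInner B ξ (R ξ))) :=
    tendsto_rightInner B tendsto_const_nhds (hR ξ)
  refine exists_tendsto_of_dist_le (b := fun e e' => √‖ω (e - e * e' - e' * e + e')‖)
    (c := fun e' => √‖rightInner B ξ (R ξ) - ω e'‖) ?_ (fun e' => ?_) ?_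
  · filter_upwards [hl.eventually_nonneg, hl.eventually_norm] with e' he' he1'
    filter_upwards [hl.eventually_nonneg, hl.eventually_norm] with e he he1
    rw [dist_eq_norm]
    exact Real.le_sqrt_of_sq_le (hv.norm_sub_sq_le s ξ he he1 he' he1')
  · have hright := (ω.continuous.tendsto e').comp (hl.tendsto_mul_right e')
    have hleft := (ω.continuous.tendsto e').comp (hl.tendsto_mul_left e')
    simpa using (((hω.sub hright).sub hleft).add_const (ω e')).norm.sqrt
  · simpa using (hω.const_sub (rightInner B ξ (R ξ))).norm.sqrt

theorem rightInner_apply_of_tendsto (hv : IsKolmogorovFamily k v) {l : Filter A}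
    (hl : l.IsIncreasingApproximateUnit) {s : S} {ξ : F} {z : E}
    (hz : Tendsto (fun e => v (e, s, ξ)) l (𝓝 z)) (q : A × S × F) :
    rightInner B (v q) z = rightInner B (k s q.2.1 q.1 q.2.2) ξ := by
  have := hl.neBot
  have hunit : Tendsto (fun e => star e * q.1) l (𝓝 q.1) :=
    (hl.tendsto_mul_right q.1).congr' (hl.eventually_star_eq.mono fun e he => by simp only [he])
  have hlim := tendsto_rightInner B hz (tendsto_const_nhds (x := v q))
  simp only [hv.rightInner_apply, ← matrixCoefficient_apply] at hlim
  have hcoeff := tendsto_nhds_unique hlim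
    (((matrixCoefficient (k s q.2.1) ξ q.2.2).continuous.tendsto q.1).comp hunit)
  rw [← star_rightInner, hcoeff, matrixCoefficient_apply, star_rightInner]

theorem exists_adjointable_rightInner_apply [CompleteSpace E] [CompleteSpace F]
    (hv : IsKolmogorovFamily k v) {l : Filter A} (hl : l.IsIncreasingApproximateUnit) {s : S}
    (hs : IsStrictAlong (k s s) l) :
    ∃ Z : Adjointable B F E, ∀ q ξ,
      rightInner B (v q) (Z ξ) = rightInner B (k s q.2.1 q.1 q.2.2) ξ := by
  have := hl.neBot
  choose z hz using hv.exists_tendsto_apply hl hs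
  have hzv q ξ := hv.rightInner_apply_of_tendsto hl (hz ξ) q
  have ext {x y : E} (h : ∀ q, rightInner B (v q) x = rightInner B (v q) y) : x = y :=
    eq_of_forall_rightInner_eq B hv.dense_span (Set.forall_mem_range.2 h)
  let Z : F →ₗ[ℂ] E :=
    { toFun := z
      map_add' ξ ξ' := ext fun q => by simp only [rightInner_add_right, hzv]
      map_smul' c ξ := ext fun q => by simp only [rightInner_smul_right, hzv, RingHom.id_apply] }
  obtain ⟨M, hM0, hM⟩ := hv.exists_norm_apply_le s
  have hZ (ξ : F) : ‖Z ξ‖ ≤ M * ‖ξ‖ := by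
    refine le_of_tendsto (hz ξ).norm (hl.eventually_norm.mono fun e he => (hM e ξ).trans ?_)
    gcongr
    exact mul_le_of_le_one_right hM0 he
  exact ⟨⟨Z.mkContinuous M hZ,
    mem_adjointableSubmodule_of_dense _ hv.dense_span fun ξ q => hzv q ξ⟩, hzv⟩

end IsKolmogorovFamily

/-! ### Decompositions of kernels -/

section Decomposition

variable {A : Type u} [NonUnitalCStarAlgebra A]
  {B : Type v} [NonUnitalCStarAlgebra B] [PartialOrder B]
  {F : Type w} [NormedAddCommGroup F] [NormedSpace ℂ F] [SMul Bᵐᵒᵖ F] [CStarModule Bᵐᵒᵖ F]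
  {S : Type x} {k : S → S → A →L[ℂ] Adjointable B F F}
  {E : CStarCorrespondence.{u, v, y₁} A B} {ζ : S → Adjointable B F E}
  {E' : CStarCorrespondence.{u, v, y₂} A B} {ζ' : S → Adjointable B F E'}

theorem isMinimalPair_iff_dense_span_range :
    IsMinimalPair E ζ ↔ Dense (Submodule.span ℂ
      (Set.range fun p : A × S × F => E.leftAction p.1 (ζ p.2.1 p.2.2)) : Set E) := by
  simp only [IsMinimalPair, Set.range, Prod.exists, eq_comm]

theorem IsDecomposition.rightInner_leftAction_apply (h : IsDecomposition k E ζ) (a : A) (s : S)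
    (ξ : F) (b : A) (t : S) (η : F) :
    rightInner B (E.leftAction a (ζ s ξ)) (E.leftAction b (ζ t η)) =
      rightInner B ξ (k s t (star a * b) η) := by
  rw [h, Adjointable.comp_apply, Adjointable.rightInner_adjoint_right, Adjointable.comp_apply,
    starAlgHom_mul_apply, rightInner_starAlgHom_apply_right _ (star a), star_star]

theorem IsDecomposition.isKolmogorovFamily (h : IsDecomposition k E ζ) (hm : IsMinimalPair E ζ) :
    IsKolmogorovFamily k fun p : A × S × F => E.leftAction p.1 (ζ p.2.1 p.2.2) :=
  ⟨h.rightInner_leftAction_apply, isMinimalPair_iff_dense_span_range.1 hm⟩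

theorem IsDecomposition.isPositiveDefiniteKernel (h : IsDecomposition k E ζ) :
    IsPositiveDefiniteKernel k := by
  intro n s a ξ
  convert rightInner_self_nonneg B (∑ i, E.leftAction (a i) (ζ (s i) (ξ i)))
  simp only [rightInner_sum_left, rightInner_sum_right, h.rightInner_leftAction_apply]
  exact Finset.sum_comm

theorem IsDecomposition.adjoint_apply (h : IsDecomposition k E ζ) (s t : S) (a : A) :
    (k s t a).adjoint = k t s (star a) :=
  (Adjointable.eq_adjoint fun ξ η => by
    simp only [h s t, h t s, Adjointable.comp_apply, Adjointable.rightInner_adjoint_left,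
      Adjointable.rightInner_adjoint_right, rightInner_starAlgHom_apply_right, star_star]).symm

variable [StarOrderedRing B]

theorem IsDecomposition.isStrictAlong [PartialOrder A] [StarOrderedRing A]
    (h : IsDecomposition k E ζ) (s : S) {l : Filter A} (hl : l.IsIncreasingApproximateUnit) :
    IsStrictAlong (k s s) l := by
  have hlim (ξ : F) : Tendsto (fun e => k s s e ξ) l (𝓝 ((ζ s).adjoint (ζ s ξ))) := by
    simp only [h s s]
    exact ((ζ s).adjoint.1.continuous.tendsto _).comp
      (tendsto_starAlgHom_apply E.nondegenerate hl (ζ s ξ))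
  have hadj : ((ζ s).adjoint.comp (ζ s)).adjoint = (ζ s).adjoint.comp (ζ s) :=
    (Adjointable.eq_adjoint fun ξ η => by
      rw [Adjointable.comp_apply, Adjointable.comp_apply, Adjointable.rightInner_adjoint_right,
        Adjointable.rightInner_adjoint_left]).symm
  refine ⟨(ζ s).adjoint.comp (ζ s), hlim, fun ξ => ?_⟩
  rw [hadj]
  refine (hlim ξ).congr' ?_
  filter_upwards [hl.eventually_star_eq] with e he
  rw [h.adjoint_apply, he]

theorem isUnitaryIso_and_comp_eq_iff (hm : IsMinimalPair E ζ) {U : Adjointable B E E'} :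
    (CStarCorrespondence.IsUnitaryIso U ∧ ∀ s, U.comp (ζ s) = ζ' s) ↔
      U.IsUnitary ∧ ∀ p : A × S × F,
        U (E.leftAction p.1 (ζ p.2.1 p.2.2)) = E'.leftAction p.1 (ζ' p.2.1 p.2.2) := by
  refine ⟨fun ⟨⟨hU, hint⟩, hζ⟩ => ⟨hU, fun p => ?_⟩, fun ⟨hU, hv⟩ => ?_⟩
  · rw [← Adjointable.comp_apply, hint, Adjointable.comp_apply, ← hζ, Adjointable.comp_apply]
  have hint (a : A) : U.comp (E.leftAction a) = (E'.leftAction a).comp U := by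
    refine Adjointable.ext_of_dense (isMinimalPair_iff_dense_span_range.1 hm)
      (Set.forall_mem_range.2 fun p => ?_)
    rw [Adjointable.comp_apply, Adjointable.comp_apply, hv, ← starAlgHom_mul_apply,
      ← starAlgHom_mul_apply]
    exact hv (a * p.1, p.2)
  refine ⟨⟨hU, hint⟩, fun s => Adjointable.ext' fun ξ => ?_⟩
  refine eq_of_forall_starAlgHom_apply_eq E'.nondegenerate fun a => ?_
  rw [Adjointable.comp_apply, ← Adjointable.comp_apply, ← hint, Adjointable.comp_apply]
  exact hv (a, s, ξ)

theorem existsUnique_isUnitaryIso (h : IsDecomposition k E ζ) (hm : IsMinimalPair E ζ)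
    (h' : IsDecomposition k E' ζ') (hm' : IsMinimalPair E' ζ') :
    ∃! U : Adjointable B E E',
      CStarCorrespondence.IsUnitaryIso U ∧ ∀ s, U.comp (ζ s) = ζ' s := by
  have hv := h.isKolmogorovFamily hm
  have hv' := h'.isKolmogorovFamily hm'
  simp only [isUnitaryIso_and_comp_eq_iff hm]
  exact existsUnique_isUnitary_apply_eq hv.dense_span hv'.dense_span fun p q => by
    rw [h.rightInner_leftAction_apply, h'.rightInner_leftAction_apply]

end Decomposition

theorem IsPositiveDefiniteKernel.exists_minimal
    {A : Type u} [NonUnitalCStarAlgebra A] [PartialOrder A] [StarOrderedRing A]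
    {B : Type v} [NonUnitalCStarAlgebra B] [PartialOrder B] [StarOrderedRing B]
    {F : Type w} [NormedAddCommGroup F] [NormedSpace ℂ F] [CompleteSpace F]
    [SMul Bᵐᵒᵖ F] [CStarModule Bᵐᵒᵖ F]
    {S : Type x} {k : S → S → A →L[ℂ] Adjointable B F F} (hk : IsPositiveDefiniteKernel k)
    (hs : ∀ s, ∃ l : Filter A, l.IsIncreasingApproximateUnit ∧ IsStrictAlong (k s s) l) :
    ∃ (E : CStarCorrespondence.{u, v, max u w x y} A B) (ζ : S → Adjointable B F E),
      IsDecomposition k E ζ ∧ IsMinimalPair E ζ := by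
  obtain ⟨E, _, _, _, _, _, v, hv⟩ := exists_isKolmogorovFamily.{u, v, w, x, y} hk
  obtain ⟨φ, hφ⟩ := hv.exists_leftAction
  choose l hl hkl using hs
  choose ζ hζ using fun s => hv.exists_adjointable_rightInner_apply (hl s) (hkl s)
  have hφζ := hv.starAlgHom_apply_eq hφ hζ
  let E' : CStarCorrespondence.{u, v, max u w x y} A B :=
    { carrier := E
      leftAction := φ
      nondegenerate := hv.dense_span.mono <| Submodule.span_mono <| by
        rintro _ ⟨⟨a, s, ξ⟩, rfl⟩
        exact ⟨a, ζ s ξ, (hφζ a s ξ).symm⟩ }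
  refine ⟨E', ζ, fun s t a => (Adjointable.ext' fun η => ?_), ?_⟩
  · refine rightInner_left_injective B fun ξ => ?_
    change _ = rightInner B ξ ((ζ s).adjoint (φ a (ζ t η)))
    rw [Adjointable.rightInner_adjoint_right, hφζ, ← star_rightInner, ← star_rightInner B (v _), hζ]
  · refine isMinimalPair_iff_dense_span_range.2 ?_
    convert hv.dense_span using 5 with p
    exact hφζ p.1 p.2.1 p.2.2

theorem mainTheorem3
    {A : Type u} [NonUnitalCStarAlgebra A] [PartialOrder A] [StarOrderedRing A]
    {B : Type v} [NonUnitalCStarAlgebra B] [PartialOrder B] [StarOrderedRing B]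
    {F : Type w} [NormedAddCommGroup F] [NormedSpace ℂ F] [CompleteSpace F]
    [SMul Bᵐᵒᵖ F] [CStarModule Bᵐᵒᵖ F]
    {S : Type x} (k : S → S → A →L[ℂ] Adjointable B F F) :
    -- the equivalence; strictness may be tested on some or on all approximate units of `A`
    List.TFAE
      [∃ (E : CStarCorrespondence.{u, v, max u w x y} A B) (ζ : S → Adjointable B F E),
          IsDecomposition k E ζ,
        IsPositiveDefiniteKernel k ∧
          ∀ s, ∃ l : Filter A, l.IsIncreasingApproximateUnit ∧ IsStrictAlong (k s s) l,
        IsPositiveDefiniteKernel k ∧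
          ∀ s, ∀ l : Filter A, l.IsIncreasingApproximateUnit → IsStrictAlong (k s s) l] ∧
    -- existence of a minimal pair
    ((IsPositiveDefiniteKernel k ∧
          ∀ s, ∃ l : Filter A, l.IsIncreasingApproximateUnit ∧ IsStrictAlong (k s s) l) →
      ∃ (E : CStarCorrespondence.{u, v, max u w x y} A B) (ζ : S → Adjointable B F E),
        IsDecomposition k E ζ ∧ IsMinimalPair E ζ) ∧
    -- uniqueness of minimal pairs
    (∀ (E : CStarCorrespondence.{u, v, y₁} A B) (ζ : S → Adjointable B F E)
        (E' : CStarCorrespondence.{u, v, y₂} A B) (ζ' : S → Adjointable B F E'),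
      IsDecomposition k E ζ → IsMinimalPair E ζ →
      IsDecomposition k E' ζ' → IsMinimalPair E' ζ' →
        ∃! U : Adjointable B E E',
          CStarCorrespondence.IsUnitaryIso U ∧ ∀ s, U.comp (ζ s) = ζ' s) := by
  refine ⟨?_, fun h => h.1.exists_minimal h.2, fun E ζ E' ζ' => existsUnique_isUnitaryIso⟩
  tfae_have 1 → 3 := fun ⟨_, _, h⟩ =>
    ⟨h.isPositiveDefiniteKernel, fun s _ hl => h.isStrictAlong s hl⟩
  tfae_have 3 → 2 := fun h => ⟨h.1, fun s =>
    have hl := CStarAlgebra.increasingApproximateUnit A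
    ⟨_, hl, h.2 s _ hl⟩⟩
  tfae_have 2 → 1 := fun h =>
    have ⟨E, ζ, hdecomp, _⟩ := IsPositiveDefiniteKernel.exists_minimal.{u, v, w, x, y} h.1 h.2
    ⟨E, ζ, hdecomp⟩
  tfae_finish
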